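/- Let $q$ be an odd prime power, and let $G_0=\mathbb F_q^2\rtimes SO_2(\mathbb F_q)$ be the group of rigid motions of the plane $\mathbb F_q^2$, where $SO_2(\mathbb F_q)$ is the group of $2\times 2$ matrices $h$ over $\mathbb F_q$ with $h^{T}h=1$ and $\det h=1$, and the group law is $(z_1,h_1)(z_2,h_2)=(z_1+h_1z_2,\,h_1h_2)$. Put $\varepsilon_q=1$ if $q\equiv 1\pmod 4$ and $\varepsilon_q=-1$ if $q\equiv 3\pmod 4$. Call a finite-dimensional complex representation $\rho$ of $G_0$ of type I if it is of the form $\rho(z,h)=\dot\rho(h)$ for a representation $\dot\rho$ of $SO_2(\mathbb F_q)$, and of type II if $\rho(z,1)$ is not the identity for some $z\in\mathbb F_q^2$. Then, up to isomorphism, $G_0$ has exactly $q-\varepsilon_q$ irreducible representations of type I, all of degree $1$, and exactly $q+\varepsilon_q$ irreducible representations of type II, all of degree $q-\varepsilon_q$. Moreover, $G_0$ is $(q-\varepsilon_q)$-quasirandom on $\mathbb F_q^2$, that is, every finite-dimensional complex representation of $G_0$ of type II, irreducible or not, has degree at least $q-\varepsilon_q$. -/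

import Mathlib

universe u v

noncomputable section

namespace RigidMotion

section SemidirectReps

variable {N H : Type*} [Group N] [Group H] {φ : H →* MulAut N}
variable {V : Type*} [AddCommGroup V] [Module ℂ V]

/-- A complex representation of `N ⋊[φ] H` is of type I if it is lifted from a representation
of `H` along the projection `N ⋊[φ] H →* H`. -/
def IsTypeI (ρ : Representation ℂ (N ⋊[φ] H) V) : Prop :=
  ∃ σ : Representation ℂ H V, ρ = σ.comp SemidirectProduct.rightHom

/-- A complex representation of `N ⋊[φ] H` is of type II if some `(z, 1)` with `z ∈ N` does not
act as the identity. -/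
def IsTypeII (ρ : Representation ℂ (N ⋊[φ] H) V) : Prop :=
  ∃ z : N, ρ (SemidirectProduct.inl z) ≠ 1

end SemidirectReps

/-- `N ⋊[φ] H` is `D`-quasirandom on `N`: every (finite-dimensional complex) representation of
type II has degree at least `D`. -/
def IsQuasirandomOn {N H : Type*} [Group N] [Group H] (φ : H →* MulAut N) (D : ℝ) : Prop :=
  ∀ (V : Type v) [AddCommGroup V] [Module ℂ V] [FiniteDimensional ℂ V]
    (ρ : Representation ℂ (N ⋊[φ] H) V), IsTypeII ρ → D ≤ (Module.finrank ℂ V : ℝ)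

/-- An irreducible finite-dimensional complex representation of `G`, with its space. -/
structure Irrep (G : Type u) [Group G] where
  /-- the representation space -/
  V : Type v
  [addCommGroup : AddCommGroup V]
  [module : Module ℂ V]
  [finiteDimensional : FiniteDimensional ℂ V]
  /-- the action -/
  ρ : Representation ℂ G V
  irreducible : ρ.IsIrreducible

attribute [instance] Irrep.addCommGroup Irrep.module Irrep.finiteDimensional

/-- The degree of an irreducible representation. -/
def Irrep.degree {G : Type u} [Group G] (σ : Irrep.{u, v} G) : ℕ := Module.finrank ℂ σ.V

/-- Isomorphism of irreducible representations. -/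
instance Irrep.setoid (G : Type u) [Group G] : Setoid (Irrep.{u, v} G) where
  r σ τ := Nonempty (σ.ρ.Equiv τ.ρ)
  iseqv :=
    { refl := fun σ => ⟨Representation.Equiv.refl σ.ρ⟩
      symm := fun ⟨e⟩ => ⟨e.symm⟩
      trans := fun ⟨e⟩ ⟨f⟩ => ⟨e.trans f⟩ }

/-- The isomorphism classes of irreducible representations of `G`. -/
abbrev IrrepClass (G : Type u) [Group G] := Quotient (Irrep.setoid.{u, v} G)

section Classes

variable {N H : Type u} [Group N] [Group H] (φ : H →* MulAut N)

/-- The isomorphism classes of irreducible representations of type I. -/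
def typeIClasses : Set (IrrepClass.{u, v} (N ⋊[φ] H)) :=
  {c | ∃ σ : Irrep.{u, v} (N ⋊[φ] H), IsTypeI σ.ρ ∧ ⟦σ⟧ = c}

/-- The isomorphism classes of irreducible representations of type II. -/
def typeIIClasses : Set (IrrepClass.{u, v} (N ⋊[φ] H)) :=
  {c | ∃ σ : Irrep.{u, v} (N ⋊[φ] H), IsTypeII σ.ρ ∧ ⟦σ⟧ = c}

end Classes

/-- The action `h ↦ (x ↦ h x)` of `SO₂(F)` on the additive group of the plane `F²`
(written multiplicatively). -/
def rotationAction (F : Type u) [Field F] :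
    Matrix.specialOrthogonalGroup (Fin 2) F →* MulAut (Multiplicative (Fin 2 → F)) where
  toFun h :=
    { toFun := fun x => Multiplicative.ofAdd (h.1.mulVec x.toAdd)
      invFun := fun x => Multiplicative.ofAdd (h⁻¹.1.mulVec x.toAdd)
      left_inv := fun x => by
        have e : h⁻¹.1 * h.1 = 1 := congrArg Subtype.val (inv_mul_cancel h)
        beta_reduce
        rw [toAdd_ofAdd, Matrix.mulVec_mulVec, e, Matrix.one_mulVec, ofAdd_toAdd]
      right_inv := fun x => by
        have e : h.1 * h⁻¹.1 = 1 := congrArg Subtype.val (mul_inv_cancel h)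
        beta_reduce
        rw [toAdd_ofAdd, Matrix.mulVec_mulVec, e, Matrix.one_mulVec, ofAdd_toAdd]
      map_mul' := fun x y => by
        rw [toAdd_mul, Matrix.mulVec_add, ofAdd_add] }
  map_one' := MulEquiv.ext fun x => congrArg Multiplicative.ofAdd (Matrix.one_mulVec x.toAdd)
  map_mul' h k := MulEquiv.ext fun x =>
    congrArg Multiplicative.ofAdd (Matrix.mulVec_mulVec x.toAdd h.1 k.1).symm

/-- The group `F² ⋊ SO₂(F)` of rigid motions of the plane over `F`. -/
abbrev RigidMotionGroup (F : Type u) [Field F] : Type u :=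
  Multiplicative (Fin 2 → F) ⋊[rotationAction F] Matrix.specialOrthogonalGroup (Fin 2) F

/-- For odd `q`, the sign `1` if `q ≡ 1 (mod 4)` and `-1` if `q ≡ 3 (mod 4)`. -/
def sign (q : ℕ) : ℤ := if q % 4 = 1 then 1 else -1

end RigidMotion

end

/-! This is the little group method in the case of trivial stabilisers. Write `N` for the plane and
`H` for `SO₂`. For `h ≠ 1` the matrix `h - 1` is invertible, so `H` acts freely on the nontrivial
characters of `N` (`isFreeOnCharacters_rotationAction`). A type II representation contains a vector
of nontrivial weight for `N`. Its `H`-translates have distinct weights, hence are independent, and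
the degree is at least `|H|`. In an irreducible representation they form a basis on which the action
is dictated by the weight, so an irreducible of type II has degree `|H|` and is determined by an
`H`-orbit of nontrivial characters. Inducing characters from `N` realises every orbit, which gives
`(q² - 1) / |H|` classes. Type I irreducibles are the `|H|` characters of the commutative group `H`.
Parametrising the unit circle gives `|H| = q - ε`. -/

namespace RigidMotion

open SemidirectProduct

/-! ### Weight vectors for the normal subgroup and their translates -/

section Weights

variable {N H : Type*} [CommGroup N] [Group H] {φ : H →* MulAut N}
variable {V : Type*} [AddCommGroup V] [Module ℂ V]

/-- The vector `v` transforms under `N` by the character `χ`. -/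
def IsWeightVector (ρ : Representation ℂ (N ⋊[φ] H) V) (χ : N →* ℂ) (v : V) : Prop :=
  ∀ z : N, ρ (inl z) v = χ z • v

variable (φ) in
/-- The translate of a character of `N` by an element of `H`. -/
def twist (χ : N →* ℂ) (h : H) : N →* ℂ := χ.comp (φ h⁻¹).toMonoidHom

@[simp]
theorem twist_apply (χ : N →* ℂ) (h : H) (z : N) : twist φ χ h z = χ (φ h⁻¹ z) := rfl

@[simp]
theorem twist_one (χ : N →* ℂ) : twist φ χ 1 = χ := by
  ext z; simp

theorem twist_ne_one {χ : N →* ℂ} (hχ : χ ≠ 1) (h : H) : twist φ χ h ≠ 1 := by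
  intro e
  apply hχ
  ext z
  simpa using DFunLike.congr_fun e (φ h z)

variable (φ) in
/-- `H` acts freely on the nontrivial characters of `N`. -/
def IsFreeOnCharacters : Prop :=
  ∀ χ : N →* ℂ, χ ≠ 1 → ∀ h : H, (∀ z, χ (φ h z) = χ z) → h = 1

theorem IsFreeOnCharacters.twist_injective (hφ : IsFreeOnCharacters φ) {χ : N →* ℂ}
    (hχ : χ ≠ 1) : Function.Injective (twist φ χ) := by
  intro h k e
  have : h⁻¹ * k = 1 := hφ χ hχ _ fun z => by
    simpa using DFunLike.congr_fun e (φ k z)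
  exact inv_mul_eq_one.1 this

theorem IsWeightVector.twist {ρ : Representation ℂ (N ⋊[φ] H) V} {χ : N →* ℂ} {v : V}
    (hv : IsWeightVector ρ χ v) (h : H) :
    IsWeightVector ρ (twist φ χ h) (ρ (inr h) v) := by
  intro z
  have e : (inl z * inr h : N ⋊[φ] H) = inr h * inl (φ h⁻¹ z) := by
    ext <;> simp
  rw [← Module.End.mul_apply, ← map_mul, e, map_mul, Module.End.mul_apply, hv, map_smul,
    twist_apply]

/-- The action on the translates of `v` is monomial, with coefficients depending only on `χ`. Hence
their span is invariant, and two irreducibles sharing a nontrivial weight can be matched translate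
by translate. -/
theorem IsWeightVector.apply_apply_inr {ρ : Representation ℂ (N ⋊[φ] H) V} {χ : N →* ℂ} {v : V}
    (hv : IsWeightVector ρ χ v) (g : N ⋊[φ] H) (h : H) :
    ρ g (ρ (inr h) v) =
      RigidMotion.twist φ χ (g.right * h) g.left • ρ (inr (g.right * h)) v := by
  conv_lhs => rw [← inl_left_mul_inr_right g]
  rw [map_mul, Module.End.mul_apply, ← Module.End.mul_apply (ρ (inr g.right)), ← map_mul,
    ← map_mul, hv.twist]

theorem apply_inr_ne_zero (ρ : Representation ℂ (N ⋊[φ] H) V) {v : V} (hv : v ≠ 0) (h : H) :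
    ρ (inr h) v ≠ 0 := by
  intro e
  apply hv
  have := congrArg (ρ (inr h⁻¹)) e
  rwa [← Module.End.mul_apply, ← map_mul, ← map_mul, inv_mul_cancel, map_one, map_one, map_zero,
    Module.End.one_apply] at this

/-- Nonzero vectors of distinct weights are linearly independent. -/
theorem linearIndependent_of_isWeightVector {ι : Type*} {ρ : Representation ℂ (N ⋊[φ] H) V}
    {χ : ι → N →* ℂ} (hχ : Function.Injective χ) {v : ι → V}
    (hv : ∀ i, IsWeightVector ρ (χ i) (v i)) (hv0 : ∀ i, v i ≠ 0) : LinearIndependent ℂ v := by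
  rw [linearIndependent_iff']
  intro s c hc i hi
  by_contra hci
  have hne : c i • v i ≠ 0 := smul_ne_zero hci (hv0 i)
  apply hne
  -- Applying a functional after `ρ (inl z)` turns the vector relation into a scalar relation
  -- between distinct characters, ruled out by Dedekind's theorem.
  rw [← Module.forall_dual_apply_eq_zero_iff ℂ]
  intro l
  have hind := (linearIndependent_monoidHom N ℂ).comp χ hχ
  rw [linearIndependent_iff'] at hind
  refine hind s (fun j => l (c j • v j)) ?_ i hi
  ext z
  have := congrArg (fun w => l (ρ (inl z) w)) hc
  simp only [map_sum, map_smul, map_zero, hv _ z] at this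
  simp only [Finset.sum_apply, Pi.smul_apply, Function.comp_apply, map_smul, smul_eq_mul,
    Pi.zero_apply] at this ⊢
  rw [← this]
  exact Finset.sum_congr rfl fun j _ => by ring

/-- If some element of `N` acts nontrivially, then there is a vector of nontrivial weight. -/
theorem IsTypeII.exists_isWeightVector [Finite N] {ρ : Representation ℂ (N ⋊[φ] H) V}
    (hρ : IsTypeII ρ) : ∃ χ : N →* ℂ, χ ≠ 1 ∧ ∃ v : V, v ≠ 0 ∧ IsWeightVector ρ χ v := by
  classical
  have := Fintype.ofFinite N
  by_contra! hcon
  obtain ⟨z₀, hz₀⟩ := hρ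
  apply hz₀
  ext v
  rw [Module.End.one_apply]
  let χ (ψ : AddChar (Additive N) ℂ) : N →* ℂ :=
    { toFun := fun z => ψ (Additive.ofMul z)
      map_one' := ψ.map_zero_eq_one
      map_mul' := fun a b => ψ.map_add_eq_mul _ _ }
  -- This is `|N|` times the projection of `v` to weight `ψ`, so these vectors sum to `|N| v`. If
  -- only the trivial weight survives, `v` is fixed by `N`.
  let e (ψ : AddChar (Additive N) ℂ) : V := ∑ z : N, χ ψ z⁻¹ • ρ (inl z) v
  have he (ψ) : IsWeightVector ρ (χ ψ) (e ψ) := by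
    intro z
    simp only [e, map_sum, map_smul, Finset.smul_sum]
    refine Fintype.sum_equiv (Equiv.mulLeft z) _ _ fun y => ?_
    rw [← Module.End.mul_apply, ← map_mul, ← map_mul, Equiv.coe_mulLeft, smul_smul, ← map_mul]
    congr 2
    simp
  have he0 (ψ) (hψ : ψ ≠ 1) : e ψ = 0 := by
    by_contra h0
    refine hcon (χ ψ) (fun h1 => hψ ?_) _ h0 (he ψ)
    ext a
    exact DFunLike.congr_fun h1 a.toMul
  have hsum : ∑ ψ, e ψ = (Fintype.card N : ℂ) • v := by
    simp only [e]
    rw [Finset.sum_comm]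
    simp_rw [← Finset.sum_smul]
    rw [Finset.sum_eq_single 1]
    · congr 1
      · simp [χ]
      · simp
    · intro z _ hz
      have : ∑ ψ, χ ψ z⁻¹ = 0 :=
        (AddChar.sum_apply_eq_zero_iff_ne_zero (a := Additive.ofMul z⁻¹)).2 (by simpa using hz)
      rw [this, zero_smul]
    · simp
  rw [Finset.sum_eq_single 1 (fun ψ _ hψ => he0 ψ hψ) (by simp)] at hsum
  have hfix : ρ (inl z₀) (e 1) = e 1 := by
    rw [he 1 z₀]
    exact one_smul _ _
  have hN : (Fintype.card N : ℂ) ≠ 0 := Nat.cast_ne_zero.2 Fintype.card_ne_zero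
  rw [hsum, map_smul] at hfix
  exact smul_right_injective V hN hfix

theorem IsWeightVector.linearIndependent (hφ : IsFreeOnCharacters φ)
    {ρ : Representation ℂ (N ⋊[φ] H) V} {χ : N →* ℂ} (hχ : χ ≠ 1) {v : V} (hv0 : v ≠ 0)
    (hv : IsWeightVector ρ χ v) : LinearIndependent ℂ fun h : H => ρ (inr h) v :=
  linearIndependent_of_isWeightVector (hφ.twist_injective hχ) hv.twist (apply_inr_ne_zero ρ hv0)

/-- A representation of type II has degree at least `|H|`. -/
theorem IsTypeII.card_le_finrank [Finite N] [Finite H] [FiniteDimensional ℂ V]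
    (hφ : IsFreeOnCharacters φ) {ρ : Representation ℂ (N ⋊[φ] H) V} (hρ : IsTypeII ρ) :
    Nat.card H ≤ Module.finrank ℂ V := by
  have := Fintype.ofFinite H
  obtain ⟨χ, hχ, v, hv0, hv⟩ := hρ.exists_isWeightVector
  rw [Nat.card_eq_fintype_card]
  exact (hv.linearIndependent hφ hχ hv0).fintype_card_le_finrank

/-- The subrepresentation generated by a weight vector. -/
def IsWeightVector.subrepresentation {ρ : Representation ℂ (N ⋊[φ] H) V} {χ : N →* ℂ} {v : V}
    (hv : IsWeightVector ρ χ v) : Subrepresentation ρ where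
  toSubmodule := Submodule.span ℂ (Set.range fun h : H => ρ (inr h) v)
  apply_mem_toSubmodule g w hw := by
    induction hw using Submodule.span_induction with
    | mem w hw =>
      obtain ⟨h, rfl⟩ := hw
      rw [hv.apply_apply_inr]
      exact Submodule.smul_mem _ _ (Submodule.subset_span ⟨_, rfl⟩)
    | zero => simp
    | add x y _ _ hx hy => rw [map_add]; exact add_mem hx hy
    | smul c x _ hx => rw [map_smul]; exact Submodule.smul_mem _ _ hx

theorem IsWeightVector.span_eq_top {ρ : Representation ℂ (N ⋊[φ] H) V} (hρ : ρ.IsIrreducible)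
    {χ : N →* ℂ} {v : V} (hv0 : v ≠ 0) (hv : IsWeightVector ρ χ v) :
    Submodule.span ℂ (Set.range fun h : H => ρ (inr h) v) = ⊤ := by
  have hmem : v ∈ hv.subrepresentation.toSubmodule :=
    Submodule.subset_span ⟨1, by simp⟩
  rcases hρ.eq_bot_or_eq_top hv.subrepresentation with h | h
  · rw [h] at hmem
    exact absurd hmem hv0
  · exact congrArg Subrepresentation.toSubmodule h

/-- The basis of an irreducible representation given by the translates of a vector of nontrivial
weight. -/
noncomputable def IsWeightVector.basis (hφ : IsFreeOnCharacters φ)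
    {ρ : Representation ℂ (N ⋊[φ] H) V} (hρ : ρ.IsIrreducible) {χ : N →* ℂ} (hχ : χ ≠ 1) {v : V}
    (hv0 : v ≠ 0) (hv : IsWeightVector ρ χ v) : Module.Basis H ℂ V :=
  .mk (hv.linearIndependent hφ hχ hv0) (hv.span_eq_top hρ hv0).ge

@[simp]
theorem IsWeightVector.basis_apply (hφ : IsFreeOnCharacters φ)
    {ρ : Representation ℂ (N ⋊[φ] H) V} (hρ : ρ.IsIrreducible) {χ : N →* ℂ} (hχ : χ ≠ 1) {v : V}
    (hv0 : v ≠ 0) (hv : IsWeightVector ρ χ v) (h : H) :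
    hv.basis hφ hρ hχ hv0 h = ρ (inr h) v :=
  Module.Basis.mk_apply _ _ _

/-- An irreducible representation of type II has degree `|H|`. -/
theorem IsTypeII.finrank_eq_card [Finite N] (hφ : IsFreeOnCharacters φ)
    {ρ : Representation ℂ (N ⋊[φ] H) V} (hρ : ρ.IsIrreducible) (h2 : IsTypeII ρ) :
    Module.finrank ℂ V = Nat.card H := by
  obtain ⟨χ, hχ, v, hv0, hv⟩ := h2.exists_isWeightVector
  exact Module.finrank_eq_nat_card_basis (hv.basis hφ hρ hχ hv0)

/-- Irreducible representations with a common nontrivial weight are isomorphic. -/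
theorem nonempty_equiv_of_isWeightVector {V' : Type*} [AddCommGroup V'] [Module ℂ V']
    (hφ : IsFreeOnCharacters φ) {ρ : Representation ℂ (N ⋊[φ] H) V}
    {ρ' : Representation ℂ (N ⋊[φ] H) V'} (hρ : ρ.IsIrreducible) (hρ' : ρ'.IsIrreducible)
    {χ : N →* ℂ} (hχ : χ ≠ 1) {v : V} (hv0 : v ≠ 0) (hv : IsWeightVector ρ χ v)
    {v' : V'} (hv0' : v' ≠ 0) (hv' : IsWeightVector ρ' χ v') : Nonempty (ρ.Equiv ρ') := by
  let b := hv.basis hφ hρ hχ hv0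
  let b' := hv'.basis hφ hρ' hχ hv0'
  let e := b.equiv b' (Equiv.refl H)
  have he (h : H) : e (ρ (inr h) v) = ρ' (inr h) v' := by
    have := b.equiv_apply h b' (Equiv.refl H)
    simpa [b, b'] using this
  refine ⟨.mk e fun g => b.ext fun h => ?_⟩
  simp only [LinearMap.comp_apply, LinearEquiv.coe_coe, b, IsWeightVector.basis_apply]
  rw [hv.apply_apply_inr, map_smul, he, he, hv'.apply_apply_inr]

end Weights

/-- A nontrivial representation all of whose nonzero subrepresentations have full dimension is
irreducible. -/
theorem isIrreducible_of_finrank_le {G V : Type*} [Group G] [AddCommGroup V] [Module ℂ V]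
    [FiniteDimensional ℂ V] [Nontrivial V] {ρ : Representation ℂ G V}
    (h : ∀ U : Subrepresentation ρ, U.toSubmodule ≠ ⊥ →
      Module.finrank ℂ V ≤ Module.finrank ℂ U.toSubmodule) : ρ.IsIrreducible where
  exists_pair_ne := by
    obtain ⟨v, hv⟩ := exists_ne (0 : V)
    refine ⟨⊥, ⊤, fun e => hv ?_⟩
    have : v ∈ (⊤ : Subrepresentation ρ) := Submodule.mem_top
    rw [← e] at this
    exact this
  eq_bot_or_eq_top U := by
    by_cases hU : U.toSubmodule = ⊥
    · exact .inl (Subrepresentation.toSubmodule_injective hU)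
    · exact .inr (Subrepresentation.toSubmodule_injective
        (Submodule.eq_top_of_finrank_eq ((Submodule.finrank_le _).antisymm (h U hU))))

/-! ### Representations induced from characters of the normal subgroup -/

section Induced

variable {N H : Type*} [CommGroup N] [Group H] (φ : H →* MulAut N)

/-- The representation induced from a character `χ` of `N`, on the functions on a set `X` in
bijection with `H`. -/
def inducedRep {X : Type*} (e : X ≃ H) (χ : N →* ℂ) : Representation ℂ (N ⋊[φ] H) (X → ℂ) where
  toFun g :=
    { toFun := fun f x => twist φ χ (e x) g.left * f (e.symm (g.right⁻¹ * e x))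
      map_add' := fun f f' => by ext x; simp [mul_add]
      map_smul' := fun c f => by ext x; simp [mul_left_comm] }
  map_one' := by
    ext f x
    simp
  map_mul' g g' := by
    ext f x
    have : (φ (e x)⁻¹) (φ g.right g'.left) = φ (g.right⁻¹ * e x)⁻¹ g'.left := by
      rw [← MulAut.mul_apply, ← map_mul, mul_inv_rev, inv_inv]
    simp only [LinearMap.coe_mk, AddHom.coe_mk, Module.End.mul_apply, twist_apply, mul_left,
      mul_right, map_mul, this, Equiv.apply_symm_apply, mul_inv_rev, mul_assoc]

variable {φ}

theorem inducedRep_apply {X : Type*} (e : X ≃ H) (χ : N →* ℂ) (g : N ⋊[φ] H) (f : X → ℂ) (x : X) :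
    inducedRep φ e χ g f x = twist φ χ (e x) g.left * f (e.symm (g.right⁻¹ * e x)) := rfl

/-- `N` acts diagonally, with weight `twist φ χ (e x)` on the coordinate `x`. -/
theorem isWeightVector_inducedRep_iff {X : Type*} (e : X ≃ H) (χ ψ : N →* ℂ) (f : X → ℂ) :
    IsWeightVector (inducedRep φ e χ) ψ f ↔ ∀ x, f x ≠ 0 → twist φ χ (e x) = ψ := by
  simp only [IsWeightVector, funext_iff, inducedRep_apply, left_inl, right_inl, inv_one, one_mul,
    Equiv.symm_apply_apply, Pi.smul_apply, smul_eq_mul, mul_eq_mul_right_iff, MonoidHom.ext_iff]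
  exact ⟨fun h x hx z => (h z x).resolve_right hx, fun h z x => by
    by_cases hx : f x = 0
    · exact .inr hx
    · exact .inl (h x hx z)⟩

theorem isWeightVector_inducedRep_single {X : Type*} [DecidableEq X] (e : X ≃ H) (χ : N →* ℂ) :
    IsWeightVector (inducedRep φ e χ) χ (Pi.single (e.symm 1) 1) := by
  rw [isWeightVector_inducedRep_iff]
  intro x hx
  by_cases h : x = e.symm 1
  · subst h; simp
  · simp [h] at hx

theorem IsWeightVector.map_equiv {V V' : Type*} [AddCommGroup V] [Module ℂ V] [AddCommGroup V']
    [Module ℂ V'] {ρ : Representation ℂ (N ⋊[φ] H) V} {ρ' : Representation ℂ (N ⋊[φ] H) V'}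
    {χ : N →* ℂ} {v : V} (hv : IsWeightVector ρ χ v) (E : ρ.Equiv ρ') :
    IsWeightVector ρ' χ (E v) := fun z => by
  rw [← map_smul, ← hv z]
  exact (E.isIntertwining _ _ _ _).symm

/-- Pull the weight-`ψ` delta function back along `E`; any point of its support supplies `h`. -/
theorem exists_twist_eq_of_equiv {X X' : Type*} {e : X ≃ H} {e' : X' ≃ H} {χ ψ : N →* ℂ}
    (E : (inducedRep φ e χ).Equiv (inducedRep φ e' ψ)) : ∃ h, twist φ χ h = ψ := by
  classical
  have hw := (isWeightVector_inducedRep_single e' ψ).map_equiv E.symm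
  have h0 : E.symm (Pi.single (e'.symm 1) 1) ≠ 0 := by
    rw [Ne, EmbeddingLike.map_eq_zero_iff]
    simp
  obtain ⟨x, hx⟩ := Function.ne_iff.1 h0
  exact ⟨_, (isWeightVector_inducedRep_iff e χ ψ _).1 hw x hx⟩

theorem isTypeII_of_isWeightVector {V : Type*} [AddCommGroup V] [Module ℂ V]
    {ρ : Representation ℂ (N ⋊[φ] H) V} {χ : N →* ℂ} (hχ : χ ≠ 1) {v : V} (hv0 : v ≠ 0)
    (hv : IsWeightVector ρ χ v) : IsTypeII ρ := by
  by_contra! hcon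
  apply hχ
  ext z
  have h := hv z
  rw [not_not.1 fun hz => hcon ⟨z, hz⟩, Module.End.one_apply] at h
  exact (smul_left_injective ℂ hv0 (by simpa using h)).symm

theorem isTypeII_inducedRep {X : Type*} (e : X ≃ H) {χ : N →* ℂ} (hχ : χ ≠ 1) :
    IsTypeII (inducedRep φ e χ) := by
  classical
  exact isTypeII_of_isWeightVector hχ (by simp) (isWeightVector_inducedRep_single e χ)

/-- All weights are twists of `χ`, hence nontrivial, so `N` fixes no nonzero vector. A nonzero
subrepresentation is therefore of type II, and the bound `|H|` already equals the full dimension. -/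
theorem isIrreducible_inducedRep [Finite N] [Finite H] {X : Type*} (hφ : IsFreeOnCharacters φ)
    (e : X ≃ H) {χ : N →* ℂ} (hχ : χ ≠ 1) : (inducedRep φ e χ).IsIrreducible := by
  have := Finite.of_equiv H e.symm
  have := Fintype.ofFinite X
  have : Nonempty X := ⟨e.symm 1⟩
  refine isIrreducible_of_finrank_le fun U hU => ?_
  rw [Module.finrank_fintype_fun_eq_card, ← Nat.card_eq_fintype_card, Nat.card_congr e]
  refine IsTypeII.card_le_finrank hφ (ρ := U.toRepresentation) ?_
  by_contra! hcon
  obtain ⟨f, hfU, hf⟩ := Submodule.exists_mem_ne_zero_of_ne_bot hU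
  have hw : IsWeightVector (inducedRep φ e χ) 1 f := fun z => by
    have h : U.toRepresentation (inl z) = 1 := not_not.1 fun hz => hcon ⟨z, hz⟩
    rw [MonoidHom.one_apply, one_smul]
    exact congrArg Subtype.val (LinearMap.congr_fun h ⟨f, hfU⟩)
  obtain ⟨x, hx⟩ := Function.ne_iff.1 hf
  exact twist_ne_one hχ _ ((isWeightVector_inducedRep_iff e χ 1 f).1 hw x hx)

end Induced

/-- The number of complex characters of a finite abelian group is its order. -/
theorem card_monoidHom_complex (A : Type*) [CommGroup A] [Finite A] :
    Nat.card (A →* ℂ) = Nat.card A := by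
  have := Fintype.ofFinite A
  let E : AddChar (Additive A) ℂ ≃ (A →* ℂ) :=
    { toFun := fun ψ =>
        { toFun := fun z => ψ (Additive.ofMul z)
          map_one' := ψ.map_zero_eq_one
          map_mul' := fun _ _ => ψ.map_add_eq_mul _ _ }
      invFun := fun χ =>
        { toFun := fun z => χ z.toMul
          map_zero_eq_one' := χ.map_one
          map_add_eq_mul' := fun _ _ => χ.map_mul _ _ }
      left_inv := fun _ => rfl
      right_inv := fun _ => rfl }
  rw [← Nat.card_congr E, Nat.card_eq_fintype_card, AddChar.card_eq, Fintype.card_additive,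
    Nat.card_eq_fintype_card]

/-! ### Counting the classes of type II -/

section TypeII

variable {N H : Type u} [CommGroup N] [Group H] [Finite N] [Finite H] {φ : H →* MulAut N}

/-- The irreducible representation induced from a nontrivial character of `N`. -/
noncomputable def inducedIrrep (hφ : IsFreeOnCharacters φ) (χ : {χ : N →* ℂ // χ ≠ 1}) :
    Irrep.{u, v} (N ⋊[φ] H) where
  -- The space must lie in universe `v` while `H` lies in `u`; this is why `inducedRep` allows an
  -- index set in bijection with `H`.
  V := Shrink.{v} H → ℂ
  finiteDimensional := have := Finite.of_equiv H (equivShrink.{v} H); inferInstance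
  ρ := inducedRep φ (equivShrink.{v} H).symm χ.1
  irreducible := isIrreducible_inducedRep hφ _ χ.2

theorem mk_inducedIrrep_eq_iff (hφ : IsFreeOnCharacters φ) (χ ψ : {χ : N →* ℂ // χ ≠ 1}) :
    (⟦inducedIrrep.{u, v} hφ χ⟧ : IrrepClass (N ⋊[φ] H)) = ⟦inducedIrrep hφ ψ⟧ ↔
      ∃ h, twist φ χ.1 h = ψ.1 := by
  classical
  rw [Quotient.eq]
  constructor
  · rintro ⟨E⟩
    exact exists_twist_eq_of_equiv E
  · rintro ⟨h, hh⟩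
    have hψ := isWeightVector_inducedRep_single (φ := φ) (equivShrink.{v} H).symm ψ.1
    have hχ := (isWeightVector_inducedRep_single (φ := φ) (equivShrink.{v} H).symm χ.1).twist h
    rw [hh] at hχ
    exact nonempty_equiv_of_isWeightVector hφ (isIrreducible_inducedRep hφ _ χ.2)
      (isIrreducible_inducedRep hφ _ ψ.2) ψ.2
      (apply_inr_ne_zero _ (Pi.single_ne_zero_iff.2 one_ne_zero) h) hχ
      (Pi.single_ne_zero_iff.2 one_ne_zero) hψ

theorem typeIIClasses_eq_range (hφ : IsFreeOnCharacters φ) :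
    typeIIClasses.{u, v} φ = Set.range fun χ => ⟦inducedIrrep.{u, v} hφ χ⟧ := by
  classical
  ext c
  constructor
  · rintro ⟨σ, h2, rfl⟩
    obtain ⟨χ, hχ, v, hv0, hv⟩ := h2.exists_isWeightVector
    refine ⟨⟨χ, hχ⟩, Quotient.sound ?_⟩
    exact nonempty_equiv_of_isWeightVector hφ (isIrreducible_inducedRep hφ _ hχ) σ.irreducible
      hχ (Pi.single_ne_zero_iff.2 one_ne_zero) (isWeightVector_inducedRep_single _ χ) hv0 hv
  · rintro ⟨χ, rfl⟩
    exact ⟨_, isTypeII_inducedRep _ χ.2, rfl⟩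

/-- The nontrivial characters of `N` fall into free orbits under `H`, one for each class of
irreducible representations of type II. -/
theorem ncard_typeIIClasses_mul_card (hφ : IsFreeOnCharacters φ) :
    (typeIIClasses.{u, v} φ).ncard * Nat.card H + 1 = Nat.card N := by
  let f : {χ : N →* ℂ // χ ≠ 1} → IrrepClass.{u, v} (N ⋊[φ] H) := fun χ => ⟦inducedIrrep hφ χ⟧
  -- Each fibre is one orbit, identified with `H` by freeness.
  have hfib (c : Set.range f) : Nonempty ({χ // Set.rangeFactorization f χ = c} ≃ H) := by
    obtain ⟨_, χ, rfl⟩ := c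
    refine ⟨(Equiv.ofBijective (fun h => ⟨⟨twist φ χ.1 h, twist_ne_one χ.2 h⟩,
      Subtype.ext ((mk_inducedIrrep_eq_iff hφ _ _).2 ⟨h, rfl⟩).symm⟩) ?_).symm⟩
    · constructor
      · intro h k e
        exact hφ.twist_injective χ.2 (congrArg (fun x => x.1.1) e)
      · rintro ⟨ψ, hψ⟩
        obtain ⟨h, hh⟩ := (mk_inducedIrrep_eq_iff hφ χ ψ).1 (congrArg Subtype.val hψ).symm
        exact ⟨h, Subtype.ext (Subtype.ext hh)⟩
  have hcard := Nat.card_congr ((Equiv.sigmaFiberEquiv (Set.rangeFactorization f)).symm.trans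
    ((Equiv.sigmaCongrRight fun c => (hfib c).some).trans (Equiv.sigmaEquivProd _ _)))
  rw [Nat.card_prod, Nat.card_coe_set_eq] at hcard
  have hfin : Finite (N →* ℂ) := Nat.finite_of_card_ne_zero
    (by rw [card_monoidHom_complex]; exact Nat.card_pos.ne')
  classical
  -- The trivial character accounts for the `+ 1`.
  rw [typeIIClasses_eq_range hφ, ← hcard, ← Finite.card_option,
    Nat.card_congr (Equiv.optionSubtypeNe (1 : N →* ℂ)), card_monoidHom_complex]

end TypeII

/-! ### Counting the classes of type I -/

section TypeI

/-- An endomorphism of a line is multiplication by its determinant. -/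
theorem eq_det_smul_one {V : Type*} [AddCommGroup V] [Module ℂ V] (hV : Module.finrank ℂ V = 1)
    (f : V →ₗ[ℂ] V) : f = LinearMap.det f • 1 := by
  obtain ⟨v, hv0, hv⟩ := finrank_eq_one_iff'.1 hV
  obtain ⟨c, hc⟩ := hv (f v)
  have hf : f = c • 1 := by
    ext w
    obtain ⟨a, rfl⟩ := hv w
    simp [← hc, smul_comm a c]
  have hdet : LinearMap.det f = c := by
    rw [hf, LinearMap.det_smul, hV]
    simp
  rwa [hdet]

variable {N H : Type u} [Group N] [Group H] {φ : H →* MulAut N}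

/-- The one-dimensional representation lifted from a character of `H`. -/
def characterRep (φ : H →* MulAut N) (χ : H →* ℂ) :
    Representation ℂ (N ⋊[φ] H) (ULift.{v} ℂ) :=
  ((algebraMap ℂ (Module.End ℂ (ULift.{v} ℂ)) : ℂ →* _).comp χ).comp rightHom

theorem finrank_ulift_complex : Module.finrank ℂ (ULift.{v} ℂ) = 1 := by
  rw [finrank_ulift, Module.finrank_self]

theorem characterRep_apply (χ : H →* ℂ) (g : N ⋊[φ] H) (x : ULift.{v} ℂ) :
    characterRep φ χ g x = χ g.right • x := rfl

theorem eq_of_characterRep_equiv {χ ψ : H →* ℂ}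
    (E : (characterRep.{u, v} φ χ).Equiv (characterRep.{u, v} φ ψ)) : χ = ψ := by
  ext h
  have h1 : E (characterRep φ χ (inr h) 1) = characterRep φ ψ (inr h) (E 1) :=
    E.isIntertwining _ _ (inr h) 1
  rw [characterRep_apply, characterRep_apply, map_smul] at h1
  refine smul_left_injective ℂ ?_ h1
  rw [Ne, EmbeddingLike.map_eq_zero_iff]
  exact one_ne_zero

/-- The irreducible representation lifted from a character of `H`. -/
def characterIrrep (φ : H →* MulAut N) (χ : H →* ℂ) : Irrep.{u, v} (N ⋊[φ] H) where
  V := ULift.{v} ℂ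
  ρ := characterRep φ χ
  irreducible := isIrreducible_of_finrank_le fun U hU => by
    rw [finrank_ulift_complex, Nat.one_le_iff_ne_zero, Ne, Submodule.finrank_eq_zero]
    exact hU

/-- A subspace stable under `σ` is stable under its lift, so `σ` inherits irreducibility, and `H` is
commutative. -/
theorem IsTypeI.finrank_eq_one [IsMulCommutative H] {V : Type*} [AddCommGroup V] [Module ℂ V]
    [FiniteDimensional ℂ V] {ρ : Representation ℂ (N ⋊[φ] H) V} (hρ : ρ.IsIrreducible)
    (h1 : IsTypeI ρ) : Module.finrank ℂ V = 1 := by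
  obtain ⟨σ, rfl⟩ := h1
  have hσ : σ.IsIrreducible :=
    { exists_pair_ne := by
        refine ⟨⊥, ⊤, fun e => ?_⟩
        have e' : (⊥ : Submodule ℂ V) = ⊤ := congrArg Subrepresentation.toSubmodule e
        exact hρ.toNontrivial.exists_pair_ne.elim fun U hU => hU.elim fun U' hU' => hU'
          (Subrepresentation.toSubmodule_injective ((subsingleton_of_bot_eq_top e').elim _ _))
      eq_bot_or_eq_top := fun U => by
        let U' : Subrepresentation (σ.comp (rightHom : N ⋊[φ] H →* H)) :=
          ⟨U.toSubmodule, fun g => U.apply_mem_toSubmodule _⟩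
        refine Or.imp (fun h => ?_) (fun h => ?_) (hρ.eq_bot_or_eq_top U')
        · exact Subrepresentation.toSubmodule_injective
            (congrArg Subrepresentation.toSubmodule h :)
        · exact Subrepresentation.toSubmodule_injective
            (congrArg Subrepresentation.toSubmodule h :) }
  exact Representation.IsIrreducible.finrank_eq_one_of_isMulCommutative σ

theorem IsTypeI.exists_equiv_characterRep {V : Type v} [AddCommGroup V] [Module ℂ V]
    {ρ : Representation ℂ (N ⋊[φ] H) V} (h1 : IsTypeI ρ) (hV : Module.finrank ℂ V = 1) :
    ∃ χ : H →* ℂ, Nonempty ((characterRep.{u, v} φ χ).Equiv ρ) := by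
  obtain ⟨σ, rfl⟩ := h1
  have := Module.finite_of_finrank_eq_succ hV
  let e : ULift.{v} ℂ ≃ₗ[ℂ] V := .ofFinrankEq _ _ (finrank_ulift_complex.trans hV.symm)
  refine ⟨(LinearMap.det : (V →ₗ[ℂ] V) →* ℂ).comp σ, ⟨.mk e fun g => LinearMap.ext fun x => ?_⟩⟩
  change e (characterRep φ _ g x) = σ g.right (e x)
  rw [characterRep_apply, map_smul, eq_det_smul_one hV (σ g.right)]
  simp

open scoped IsMulCommutative in
theorem ncard_typeIClasses [Finite H] [IsMulCommutative H] (φ : H →* MulAut N) :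
    (typeIClasses.{u, v} φ).ncard = Nat.card H := by
  let f : (H →* ℂ) → IrrepClass.{u, v} (N ⋊[φ] H) := fun χ => ⟦characterIrrep φ χ⟧
  have hf : Function.Injective f := by
    intro χ ψ e
    obtain ⟨E⟩ := Quotient.exact e
    exact eq_of_characterRep_equiv E
  have hrange : typeIClasses.{u, v} φ = Set.range f := by
    ext c
    constructor
    · rintro ⟨σ, h1, rfl⟩
      obtain ⟨χ, hχ⟩ := h1.exists_equiv_characterRep (h1.finrank_eq_one σ.irreducible)
      exact ⟨χ, Quotient.sound hχ⟩
    · rintro ⟨χ, rfl⟩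
      exact ⟨_, ⟨_, rfl⟩, rfl⟩
  rw [hrange, ← Nat.card_coe_set_eq, ← Nat.card_congr (Equiv.ofInjective f hf),
    card_monoidHom_complex]

end TypeI

/-! ### Rotations of the plane: commutativity, freeness, order -/

section Plane

variable {F : Type u} [Field F]

open Matrix

instance : IsMulCommutative (specialOrthogonalGroup (Fin 2) F) where
  is_comm := ⟨fun a b => by
    obtain ⟨a1, a2, -⟩ := mem_specialOrthogonalGroup_fin_two_iff.1 a.2
    obtain ⟨b1, b2, -⟩ := mem_specialOrthogonalGroup_fin_two_iff.1 b.2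
    refine Subtype.ext ?_
    ext i j
    fin_cases i <;> fin_cases j <;>
      simp [Matrix.mul_apply, Fin.sum_univ_two, a1, a2, b1, b2] <;> ring⟩

/-- A rotation is determined by its first column, a point of the unit circle. -/
def rotationEquivCircle (F : Type u) [Field F] :
    specialOrthogonalGroup (Fin 2) F ≃ {p : F × F // p.1 ^ 2 + p.2 ^ 2 = 1} where
  toFun h := ⟨(h.1 1 1, h.1 1 0), by
    obtain ⟨h1, h2, h3⟩ := mem_specialOrthogonalGroup_fin_two_iff.1 h.2
    rw [h1, h2] at h3
    simpa using h3⟩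
  invFun p := ⟨!![p.1.1, -p.1.2; p.1.2, p.1.1], by
    rw [of_mem_specialOrthogonalGroup_fin_two_iff]
    exact ⟨rfl, rfl, by simpa using p.2⟩⟩
  left_inv h := by
    obtain ⟨h1, h2, -⟩ := mem_specialOrthogonalGroup_fin_two_iff.1 h.2
    refine Subtype.ext ?_
    ext i j
    fin_cases i <;> fin_cases j <;> simp [h1, h2]
  right_inv p := by simp

/-- The rational parametrization of the unit circle by the lines through `(-1, 0)`. -/
def circleEquivOption [DecidableEq F] (h2 : (2 : F) ≠ 0) :
    {p : F × F // p.1 ^ 2 + p.2 ^ 2 = 1} ≃ Option {t : F // t ^ 2 ≠ -1} where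
  toFun p := if h : p.1.1 = -1 then none else some ⟨p.1.2 / (p.1.1 + 1), fun ht => by
    have h0 : p.1.1 + 1 ≠ 0 := fun e => h (eq_neg_of_add_eq_zero_left e)
    rw [div_pow, div_eq_iff (pow_ne_zero 2 h0)] at ht
    -- On the circle `(a + 1)² + b² = 2(a + 1)`, so a slope with square `-1` would force `2(a + 1) =
    -- 0`.
    refine mul_ne_zero h2 h0 ?_
    linear_combination ht - p.2⟩
  invFun
    | none => ⟨(-1, 0), by ring⟩
    | some t => ⟨((1 - t.1 ^ 2) / (1 + t.1 ^ 2), 2 * t.1 / (1 + t.1 ^ 2)), by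
        have h0 : 1 + t.1 ^ 2 ≠ 0 := fun e => t.2 (eq_neg_of_add_eq_zero_right e)
        field_simp
        ring⟩
  left_inv p := by
    obtain ⟨⟨a, b⟩, hp⟩ := p
    dsimp only at hp ⊢
    split_ifs with h
    · subst h
      have hb : b = 0 := by simpa using hp
      subst hb
      rfl
    · have h0 : a + 1 ≠ 0 := fun e => h (eq_neg_of_add_eq_zero_left e)
      have h1 : 1 + (b / (a + 1)) ^ 2 = 2 / (a + 1) := by
        field_simp
        linear_combination hp
      refine Subtype.ext (Prod.ext ?_ ?_)
      · dsimp only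
        rw [h1, div_eq_iff (div_ne_zero h2 h0)]
        field_simp
        linear_combination -hp
      · dsimp only
        rw [h1]
        field_simp
  right_inv t := by
    obtain _ | ⟨t, ht⟩ := t
    · simp
    · have h0 : 1 + t ^ 2 ≠ 0 := fun e => ht (eq_neg_of_add_eq_zero_right e)
      have h1 : (1 - t ^ 2) / (1 + t ^ 2) + 1 = 2 / (1 + t ^ 2) := by
        field_simp
        ring
      have h3 : (1 - t ^ 2) / (1 + t ^ 2) ≠ -1 := fun e => by
        rw [e, neg_add_cancel] at h1
        exact div_ne_zero h2 h0 h1.symm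
      simp only [h3, dite_false, h1, Option.some_inj, Subtype.mk.injEq]
      field_simp

/-- A character invariant under `h` is trivial on the image of `h - 1`. With first column `(a, b)`,
`det (h - 1) = 2 - 2a`, which vanishes only if `a = 1`, hence `b = 0` and `h = 1`. -/
theorem isFreeOnCharacters_rotationAction (h2 : (2 : F) ≠ 0) :
    IsFreeOnCharacters (rotationAction F) := by
  intro χ hχ h hh
  by_contra hne
  apply hχ
  obtain ⟨h1, h3, h4⟩ := mem_specialOrthogonalGroup_fin_two_iff.1 h.2
  have hdet : IsUnit (h.1 - 1).det := by
    rw [isUnit_iff_ne_zero, det_fin_two]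
    simp only [Matrix.sub_apply, one_apply_eq, one_apply_ne zero_ne_one, one_apply_ne one_ne_zero,
      h1, h3]
    intro e
    rw [h1, h3] at h4
    have ha : h.1 1 1 = 1 := mul_left_cancel₀ h2 (by linear_combination h4 - e)
    have hb : h.1 1 0 = 0 := by simpa [ha] using h4
    refine hne (Subtype.ext ?_)
    ext i j
    fin_cases i <;> fin_cases j <;> simp [h1, h3, ha, hb]
  refine MonoidHom.ext fun x => ?_
  have hx : (h.1 - 1) *ᵥ ((h.1 - 1)⁻¹ *ᵥ x.toAdd) = x.toAdd := by
    rw [mulVec_mulVec, mul_nonsing_inv _ hdet, one_mulVec]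
  set y := (h.1 - 1)⁻¹ *ᵥ x.toAdd
  rw [sub_mulVec, one_mulVec, sub_eq_iff_eq_add] at hx
  have hy : χ (Multiplicative.ofAdd (h.1 *ᵥ y)) = χ (Multiplicative.ofAdd y) :=
    hh (Multiplicative.ofAdd y)
  rw [hx, ofAdd_add, map_mul, ofAdd_toAdd] at hy
  have hy0 : χ (Multiplicative.ofAdd y) ≠ 0 := (Group.isUnit _).map χ |>.ne_zero
  simpa using mul_right_cancel₀ hy0 (hy.trans (one_mul _).symm)

variable [Fintype F]

theorem quadraticChar_neg_one_eq_sign [DecidableEq F] (hF : ringChar F ≠ 2)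
    (hodd : Odd (Fintype.card F)) : quadraticChar F (-1) = sign (Fintype.card F) := by
  rw [quadraticChar_neg_one hF, ZMod.χ₄_nat_eq_if_mod_four, sign, if_neg]
  rw [Nat.odd_iff] at hodd
  omega

/-- The circle has `1 + (q - r)` points, where `r = 1 + ε` is the number of square roots of `-1`,
read off from the quadratic character. -/
theorem card_specialOrthogonalGroup (hF : ringChar F ≠ 2) (hodd : Odd (Fintype.card F)) :
    (Nat.card (specialOrthogonalGroup (Fin 2) F) : ℤ) =
      Fintype.card F - sign (Fintype.card F) := by
  classical
  have h2 : (2 : F) ≠ 0 := Ring.two_ne_zero hF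
  have hs := quadraticChar_card_sqrts hF (-1 : F)
  rw [quadraticChar_neg_one_eq_sign hF hodd, Set.toFinset_card] at hs
  rw [Nat.card_congr ((rotationEquivCircle F).trans (circleEquivOption h2)),
    Nat.card_eq_fintype_card, Fintype.card_option]
  have hc := Fintype.card_subtype_compl (fun t : F => t ^ 2 = -1)
  have hle := Fintype.card_subtype_le (fun t : F => t ^ 2 = -1)
  have hs' : (Fintype.card {t : F // t ^ 2 = -1} : ℤ) = sign (Fintype.card F) + 1 := by
    rw [← hs]
    exact congrArg _ (Fintype.card_congr (Equiv.refl _))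
  have hc' : Fintype.card {t : F // t ^ 2 ≠ -1} =
      Fintype.card F - Fintype.card {t : F // t ^ 2 = -1} := by
    rw [← hc]
  omega

end Plane

end RigidMotion

theorem theorem5 (F : Type u) [Field F] [Fintype F] (q : ℕ) (hq : Fintype.card F = q)
    (hodd : Odd q) :
    -- exactly `q - ε` irreducible representations of type I, all of degree `1`
    ((RigidMotion.typeIClasses.{u, v} (RigidMotion.rotationAction F)).ncard : ℤ)
        = q - RigidMotion.sign q ∧
    (∀ σ : RigidMotion.Irrep.{u, v} (RigidMotion.RigidMotionGroup F),
      RigidMotion.IsTypeI σ.ρ → σ.degree = 1) ∧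
    -- exactly `q + ε` irreducible representations of type II, all of degree `q - ε`
    ((RigidMotion.typeIIClasses.{u, v} (RigidMotion.rotationAction F)).ncard : ℤ)
        = q + RigidMotion.sign q ∧
    (∀ σ : RigidMotion.Irrep.{u, v} (RigidMotion.RigidMotionGroup F),
      RigidMotion.IsTypeII σ.ρ → (σ.degree : ℤ) = q - RigidMotion.sign q) ∧
    -- the quasirandomness of the group of rigid motions on the plane
    RigidMotion.IsQuasirandomOn.{v} (RigidMotion.rotationAction F)
      ((q : ℝ) - (RigidMotion.sign q : ℝ)) := by
  subst hq
  have hF : ringChar F ≠ 2 := fun h => by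
    have := FiniteField.even_card_of_char_two h
    rw [Nat.odd_iff] at hodd
    omega
  have hφ := RigidMotion.isFreeOnCharacters_rotationAction (Ring.two_ne_zero hF)
  have hH := RigidMotion.card_specialOrthogonalGroup hF hodd
  refine ⟨?_, fun σ h => h.finrank_eq_one σ.irreducible, ?_, fun σ h => ?_, ?_⟩
  · rw [RigidMotion.ncard_typeIClasses, hH]
  · have h := RigidMotion.ncard_typeIIClasses_mul_card.{u, v} hφ
    have hN : Nat.card (Multiplicative (Fin 2 → F)) = Fintype.card F ^ 2 := by
      rw [Nat.card_eq_fintype_card, Fintype.card_multiplicative, Fintype.card_fun,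
        Fintype.card_fin]
    rw [hN] at h
    zify at h
    rw [hH] at h
    have hs : RigidMotion.sign (Fintype.card F) ^ 2 = 1 := by
      rw [RigidMotion.sign]
      split_ifs <;> norm_num
    have hpos : (Fintype.card F : ℤ) - RigidMotion.sign (Fintype.card F) ≠ 0 := by
      rw [← hH]
      exact_mod_cast Nat.card_pos.ne'
    -- Since `ε² = 1`, `q² - 1 = (q + ε)(q - ε)`, and the factor `q - ε = |H|` cancels.
    refine mul_right_cancel₀ hpos ?_
    linear_combination h + hs
  · rw [RigidMotion.Irrep.degree, h.finrank_eq_card hφ σ.irreducible, hH]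
  · intro V _ _ _ ρ h
    have := h.card_le_finrank hφ
    have hH' : ((Nat.card (Matrix.specialOrthogonalGroup (Fin 2) F) : ℤ) : ℝ) = _ :=
      congrArg Int.cast hH
    push_cast at hH'
    rw [← hH']
    exact_mod_cast this
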